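/- All graphs are finite, simple and undirected. Let $G=(V,E)$ be a graph and $X,Y\subseteq V$. A set $S\subseteq V$ is an $(X,Y)$-separator if $G-S$ contains no path from a vertex of $X$ to a vertex of $Y$ (the sets $X,Y,S$ may intersect); it is minimal if no proper subset of $S$ is an $(X,Y)$-separator. Let $V_{X,S}$ (respectively $V_{S,Y}$) be the set of vertices of $G-S$ reachable in $G-S$ from $X\setminus S$ (respectively from $Y\setminus S$). A minimal $(X,Y)$-separator $S$ with $|S|\le k$ is - a leftmost $(X,Y,\le k)$-separator if there is no minimal $(X,Y)$-separator $S'\ne S$ with $|S'|\le k$ and $V_{X,S'}\subseteq V_{X,S}$; - an important $(X,Y,\le k)$-separator if there is no minimal $(X,Y)$-separator $S'\neq S$ with $|S'|\le k$, $|S'|\le|S|$ and $V_{S,Y}\subsetneq V_{S',Y}$. Let $C_n$ be the $n$-th Catalan number. **Theorem.** For every integer $k\ge 1$, every graph $G=(V,E)$ and all $X,Y\subseteq V$, the number of leftmost $(X,Y,\le k)$-separators is at most $$C_{k-1}=\frac1k\binom{2(k-1)}{k-1},$$ and the number of important $(X,Y,\le k)$-separators is at most $\sum_{i=0}^{k-1}C_i$.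 Both bounds are tight for every $k\ge1$: if $G$ is the complete binary tree of depth $d\ge k+1$ (every leaf at distance $d$ from the root), $X$ is the set of its leaves and $Y$ consists of its root, then there are exactly $C_{k-1}$ leftmost and exactly $\sum_{i=0}^{k-1}C_i$ important $(X,Y,\le k)$-separators. Moreover, $C_{k-1}\sim \dfrac{4^{k-1}}{\sqrt{\pi}\,(k-1)^{3/2}}$ as $k\to\infty$. -/

import Mathlib

namespace LeftmostSep

/-- The vertices of `G - S` that can be reached in `G - S` from a vertex of `A \ S`. -/
def reach {V : Type*} (G : SimpleGraph V) (A : Set V) (S : Finset V) : Set V :=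
  {v | ∃ a ∈ A, ∃ p : G.Walk a v, ∀ w ∈ p.support, w ∉ S}

/-- `S` is an `(X, Y)`-separator: `G - S` contains no path from `X` to `Y`.
The sets `X`, `Y` and `S` may intersect. -/
def IsSeparator {V : Type*} (G : SimpleGraph V) (X Y : Set V) (S : Finset V) : Prop :=
  ∀ x ∈ X, ∀ y ∈ Y, ∀ p : G.Walk x y, ∃ w ∈ p.support, w ∈ S

/-- `S` is an inclusion-minimal `(X, Y)`-separator and has at most `k` vertices. -/
def IsMinimalSeparatorLE {V : Type*} (G : SimpleGraph V) (X Y : Set V) (k : ℕ)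
    (S : Finset V) : Prop :=
  Minimal (IsSeparator G X Y) S ∧ S.card ≤ k

/-- `S` is at least as much to the left as `S'`: `V_{X,S} ⊆ V_{X,S'}`. -/
def AtLeastAsLeft {V : Type*} (G : SimpleGraph V) (X : Set V) (S S' : Finset V) : Prop :=
  reach G X S ⊆ reach G X S'

/-- `S` is a leftmost `(X, Y, ≤ k)`-separator. -/
def IsLeftmost {V : Type*} (G : SimpleGraph V) (X Y : Set V) (k : ℕ) (S : Finset V) : Prop :=
  IsMinimalSeparatorLE G X Y k S ∧
    ¬ ∃ S', S' ≠ S ∧ IsMinimalSeparatorLE G X Y k S' ∧ AtLeastAsLeft G X S' S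

/-- `S` dominates `S'`: it is not larger, and the part of the graph on the side of `Y`
is strictly larger for `S`, that is `V_{S',Y} ⊂ V_{S,Y}`. -/
def Dominates {V : Type*} (G : SimpleGraph V) (Y : Set V) (S S' : Finset V) : Prop :=
  S.card ≤ S'.card ∧ reach G Y S' ⊂ reach G Y S

/-- `S` is an important `(X, Y, ≤ k)`-separator. -/
def IsImportant {V : Type*} (G : SimpleGraph V) (X Y : Set V) (k : ℕ) (S : Finset V) : Prop :=
  IsMinimalSeparatorLE G X Y k S ∧
    ¬ ∃ S', S' ≠ S ∧ IsMinimalSeparatorLE G X Y k S' ∧ Dominates G Y S' S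

/-- Vertices of the complete binary tree of depth `d`: words over `Bool` of length at most `d`;
the root is the empty word and the children of `l` are `false :: l` and `true :: l`. -/
abbrev BinVertex (d : ℕ) : Type := {l : List Bool // l.length ≤ d}

/-- The complete binary tree of depth `d` (every leaf has distance `d` from the root). -/
def completeBinaryTree (d : ℕ) : SimpleGraph (BinVertex d) where
  Adj u v := (∃ b, v.1 = b :: u.1) ∨ (∃ b, u.1 = b :: v.1)
  symm := ⟨fun _ _ h => h.symm⟩
  loopless := ⟨fun u h => by
    rcases h with ⟨b, hb⟩ | ⟨b, hb⟩ <;> simpa using congrArg List.length hb⟩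

/-- The root of the complete binary tree. -/
def treeRoot (d : ℕ) : BinVertex d := ⟨[], Nat.zero_le d⟩

/-- The leaves of the complete binary tree of depth `d`. -/
def treeLeaves (d : ℕ) : Set (BinVertex d) := {v | v.1.length = d}

end LeftmostSep

/-!
Identify a minimal separator `S` with the set `D` of vertices that `Y` reaches in `G - S`: then `S`
is the boundary of `D`, and the leftmost separators correspond to maximal sets `D` among those that
avoid `X` and have at most `k` boundary vertices. The boundary size is submodular, so a largest
set `B` of least boundary size `m` lies inside every maximal `D`. Choose a boundary vertex of `B`
and decide whether it belongs to `D`. If it does, the least boundary size grows, so this happens at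
most `k - m` times. If it does not, it stays in the boundary for good, so this happens at most `m`
times before the set is determined. The resulting recursion is that of the ballot numbers, and the
whole search has `C_{k-1}` branches. An important separator is a leftmost one for the budget `|S|`,
which gives the sum of Catalan numbers.

In the complete binary tree, the leaf sets of the binary trees with `k - 1` inner nodes are leftmost
separators, and binary trees are counted by Catalan numbers.
-/

namespace LeftmostSep

section Catalan

open Filter Asymptotics PowerSeries
open scoped Nat

/-- The ballot numbers: the coefficient of `x ^ s` in the `r`-th power of the Catalan series, which
is the number of `r`-tuples of binary trees with `s` inner nodes in total. They bound the number of
branches of the search in `encard_maximal_isRegion_le`. -/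
noncomputable def ballot (r s : ℕ) : ℕ := coeff s (catalanSeries ^ r)

theorem ballot_one (s : ℕ) : ballot 1 s = catalan s := by simp [ballot]

theorem ballot_zero_right (r : ℕ) : ballot r 0 = 1 := by simp [ballot]

theorem ballot_succ_succ (r s : ℕ) :
    ballot (r + 1) (s + 1) = ballot r (s + 1) + ballot (r + 2) s := by
  have hpow : catalanSeries ^ (r + 1) = catalanSeries ^ r + X * catalanSeries ^ (r + 2) := by
    calc catalanSeries ^ (r + 1) = catalanSeries ^ r * (catalanSeries ^ 2 * X + 1) := by
          rw [catalanSeries_sq_mul_X_add_one, pow_succ]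
      _ = catalanSeries ^ r + X * catalanSeries ^ (r + 2) := by ring
  rw [ballot, hpow, map_add, coeff_succ_X_mul]
  rfl

theorem ballot_add_two_le (r s : ℕ) : ballot (r + 2) s ≤ ballot (r + 1) (s + 1) :=
  (Nat.le_add_left _ _).trans_eq (ballot_succ_succ r s).symm

theorem one_le_ballot_succ (r s : ℕ) : 1 ≤ ballot (r + 1) s := by
  induction s generalizing r with
  | zero => rw [ballot_zero_right]
  | succ s ih => exact (ih (r + 1)).trans (ballot_add_two_le r s)

theorem one_le_catalan (n : ℕ) : 1 ≤ catalan n :=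
  ballot_one n ▸ one_le_ballot_succ 0 n

theorem cast_catalan (n : ℕ) : (catalan n : ℝ) = (n.centralBinom : ℝ) / (n + 1) := by
  rw [eq_div_iff (by positivity), mul_comm]
  exact_mod_cast succ_mul_catalan_eq_centralBinom n

theorem cast_catalan_pred {k : ℕ} (hk : 1 ≤ k) :
    (catalan (k - 1) : ℝ) = 1 / (k : ℝ) * ((2 * (k - 1)).choose (k - 1) : ℝ) := by
  rw [cast_catalan, Nat.centralBinom_eq_two_mul_choose, Nat.cast_pred hk, sub_add_cancel,
    one_div_mul_eq_div]

theorem centralBinom_isEquivalent :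
    (fun n : ℕ => (n.centralBinom : ℝ)) ~[atTop] fun n : ℕ => 4 ^ n / √(Real.pi * n) := by
  have hdouble : Tendsto (fun n : ℕ => 2 * n) atTop atTop :=
    tendsto_id.const_mul_atTop' two_pos
  have hstirling := Stirling.factorial_isEquivalent_stirling
  have hquot := (hstirling.comp_tendsto hdouble).div (hstirling.pow 2)
  refine (hquot.congr_left (.of_forall fun n => ?_)).congr_right ?_
  · have hchoose : (n.centralBinom : ℝ) = (2 * n)! / (n ! : ℝ) ^ 2 := by
      rw [Nat.centralBinom_eq_two_mul_choose, Nat.cast_choose ℝ (by lia), two_mul,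
        Nat.add_sub_cancel, sq]
    exact hchoose.symm
  · filter_upwards [eventually_ne_atTop 0] with n hn
    have : (0 : ℝ) < n := by positivity
    have hpow : (2 * (n : ℝ) / Real.exp 1) ^ (2 * n) = 4 ^ n * ((n / Real.exp 1) ^ n) ^ 2 := by
      rw [mul_div_assoc, mul_pow, pow_mul, ← pow_mul (_ / _), mul_comm n 2]
      norm_num
    have hsqrt : √(2 * (2 * n) * Real.pi) = 2 * √(Real.pi * n) := by
      rw [show 2 * (2 * (n : ℝ)) * Real.pi = 2 ^ 2 * (Real.pi * n) by ring,
        Real.sqrt_mul (by positivity), Real.sqrt_sq two_pos.le]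
    have hsq : √(2 * n * Real.pi) ^ 2 = 2 * √(Real.pi * n) ^ 2 := by
      rw [Real.sq_sqrt (by positivity), Real.sq_sqrt (by positivity)]
      ring
    simp only [Function.comp_apply, Pi.div_apply, Pi.pow_apply, Nat.cast_mul, Nat.cast_ofNat]
    rw [hpow, hsqrt, mul_pow, hsq]
    field_simp

theorem catalan_isEquivalent :
    (fun n : ℕ => (catalan n : ℝ)) ~[atTop]
      fun n : ℕ => (4 : ℝ) ^ n / (√Real.pi * (n : ℝ) ^ (3 / 2 : ℝ)) := by
  have hsucc : (fun n : ℕ => (n : ℝ) + 1) ~[atTop] fun n : ℕ => (n : ℝ) :=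
    IsEquivalent.refl.add_isLittleO (isLittleO_const_id_atTop (1 : ℝ)).natCast_atTop
  refine ((centralBinom_isEquivalent.div hsucc).congr_left
    (.of_forall fun n => (cast_catalan n).symm)).congr_right ?_
  filter_upwards [eventually_gt_atTop 0] with n hn
  have hpos : (0 : ℝ) < n := by positivity
  have hpow : (n : ℝ) ^ (3 / 2 : ℝ) = √(n : ℝ) * n := by
    rw [Real.sqrt_eq_rpow, ← Real.rpow_add_one hpos.ne']
    norm_num
  simp only [Pi.div_apply]
  rw [hpow, div_div, Real.sqrt_mul Real.pi_pos.le, mul_assoc]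

theorem catalan_pred_isEquivalent :
    (fun k : ℕ => (catalan (k - 1) : ℝ)) ~[atTop]
      fun k : ℕ => (4 : ℝ) ^ (k - 1) / (√Real.pi * ((k : ℝ) - 1) ^ (3 / 2 : ℝ)) := by
  refine (catalan_isEquivalent.comp_tendsto (tendsto_sub_atTop_nat 1)).congr_right ?_
  filter_upwards [eventually_ge_atTop 1] with k hk
  simp only [Function.comp_apply, Nat.cast_pred hk]

end Catalan

section Boundary

variable {V : Type*} {G : SimpleGraph V} {Y A B D E F : Set V} {S : Finset V} {v : V}

variable (G Y) in
/-- The vertices outside `D` that lie in `Y` or have a neighbour in `D`. Counting the vertices of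
`Y` treats `Y` as the neighbourhood of an extra vertex that belongs to every `D`. -/
def boundary (D : Set V) : Set V := (Y ∪ ⋃ u ∈ D, G.neighborSet u) \ D

variable (G Y) in
/-- Every vertex of `D` is joined to `Y` by a walk inside `D`. The sets `reach G Y S` have this
property, and it keeps irrelevant components out of the sets that are counted. -/
def Attached (D : Set V) : Prop :=
  ∀ v ∈ D, ∃ y ∈ Y, ∃ p : G.Walk y v, ∀ w ∈ p.support, w ∈ D

theorem mem_boundary : v ∈ boundary G Y D ↔ (v ∈ Y ∨ ∃ u ∈ D, G.Adj u v) ∧ v ∉ D := by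
  simp [boundary]

theorem disjoint_boundary (D : Set V) : Disjoint D (boundary G Y D) :=
  Set.disjoint_sdiff_right

theorem boundary_sdiff_subset (h : A ⊆ B) : boundary G Y A \ B ⊆ boundary G Y B :=
  fun _ hv => ⟨Set.union_subset_union_right Y (Set.biUnion_subset_biUnion_left h) hv.1.1, hv.2⟩

theorem boundary_inter_subset (h : A ⊆ B) (hF : Disjoint B F) :
    boundary G Y A ∩ F ⊆ boundary G Y B ∩ F :=
  fun _ hv => ⟨boundary_sdiff_subset h ⟨hv.1, hF.notMem_of_mem_right hv.2⟩, hv.2⟩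

theorem encard_boundary_inter_add_one_le (h : A ⊆ B) (hF : Disjoint B F)
    (hv : v ∈ boundary G Y B \ F) :
    (boundary G Y A ∩ F).encard + 1 ≤ (boundary G Y B ∩ insert v F).encard := by
  rw [← Set.encard_insert_of_notMem fun hvA => hv.2 hvA.2]
  exact Set.encard_le_encard (Set.insert_subset ⟨hv.1, Set.mem_insert v F⟩
    ((boundary_inter_subset h hF).trans (Set.inter_subset_inter_right _ (Set.subset_insert v F))))

theorem encard_boundary_union_add_encard_boundary_inter_le (A B : Set V) :
    (boundary G Y (A ∪ B)).encard + (boundary G Y (A ∩ B)).encard ≤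
      (boundary G Y A).encard + (boundary G Y B).encard := by
  rw [← Set.encard_union_add_encard_inter, ← Set.encard_union_add_encard_inter (boundary G Y A)]
  refine add_le_add (Set.encard_le_encard fun v => ?_) (Set.encard_le_encard fun v => ?_) <;>
  · simp only [Set.mem_union, Set.mem_inter_iff, mem_boundary]
    grind

theorem encard_boundary_sUnion_le {c : Set (Set V)} (hc : DirectedOn (· ⊆ ·) c)
    (hne : c.Nonempty) {k : ℕ} (hk : ∀ D ∈ c, (boundary G Y D).encard ≤ k) :
    (boundary G Y (⋃₀ c)).encard ≤ k := by
  by_contra! hlt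
  obtain ⟨T, hT, hTk⟩ := Set.exists_subset_encard_eq (Order.add_one_le_of_lt hlt)
  have hTfin : T.Finite := Set.finite_of_encard_eq_coe (k := k + 1) (by simpa using hTk)
  have hcover : T ⊆ ⋃ D ∈ c, Y ∪ ⋃ u ∈ D, G.neighborSet u := by
    intro v hv
    obtain ⟨hvY | ⟨u, ⟨D, hD, hu⟩, huv⟩, -⟩ := mem_boundary.1 (hT hv)
    · obtain ⟨D, hD⟩ := hne
      exact Set.mem_biUnion hD (.inl hvY)
    · exact Set.mem_biUnion hD (.inr (Set.mem_biUnion hu huv))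
  have hdir : DirectedOn (fun D E => Y ∪ ⋃ u ∈ D, G.neighborSet u ⊆ Y ∪ ⋃ u ∈ E, G.neighborSet u)
      c :=
    hc.mono fun _ _ h => Set.union_subset_union_right Y (Set.biUnion_subset_biUnion_left h)
  obtain ⟨D, hD, hTD⟩ := hdir.exists_mem_subset_of_finset_subset_biUnion hne
    (s := hTfin.toFinset) (by simpa using hcover)
  have hTb : T ⊆ boundary G Y D := fun v hv =>
    ⟨hTD (by simpa using hv), fun hvD => (hT hv).2 (Set.mem_sUnion_of_mem hvD hD)⟩
  have hle := (Set.encard_le_encard hTb).trans (hk D hD)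
  rw [hTk] at hle
  exact absurd hle (by norm_cast; simp)

theorem attached_empty : Attached G Y ∅ := fun _ h => h.elim

theorem attached_sUnion {c : Set (Set V)} (hc : ∀ D ∈ c, Attached G Y D) :
    Attached G Y (⋃₀ c) := by
  rintro v ⟨D, hD, hv⟩
  obtain ⟨y, hy, p, hp⟩ := hc D hD v hv
  exact ⟨y, hy, p, fun w hw => ⟨D, hD, hp w hw⟩⟩

theorem Attached.union (hD : Attached G Y D) (hE : Attached G Y E) : Attached G Y (D ∪ E) := by
  rw [← Set.sUnion_pair]
  exact attached_sUnion (by simp [hD, hE])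

theorem Attached.insert (hD : Attached G Y D) (hv : v ∈ boundary G Y D) :
    Attached G Y (insert v D) := by
  rintro w (rfl | hw)
  · obtain ⟨hwY | ⟨u, hu, huw⟩, -⟩ := mem_boundary.1 hv
    · exact ⟨w, hwY, .nil, by simp⟩
    · obtain ⟨y, hy, p, hp⟩ := hD u hu
      refine ⟨y, hy, p.concat huw, fun z hz => ?_⟩
      rw [SimpleGraph.Walk.support_concat, List.mem_append, List.mem_singleton] at hz
      exact hz.symm.imp_right (hp z)
  · obtain ⟨y, hy, p, hp⟩ := hD w hw
    exact ⟨y, hy, p, fun z hz => .inr (hp z hz)⟩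

theorem Attached.subset_of_disjoint_boundary (hD : Attached G Y D)
    (h : Disjoint D (boundary G Y A)) : D ⊆ A := by
  intro v hv
  obtain ⟨y, hy, p, hp⟩ := hD v hv
  have hyA : y ∈ A := by
    by_contra hyA
    exact h.notMem_of_mem_left (hp y p.start_mem_support) (mem_boundary.2 ⟨.inl hy, hyA⟩)
  by_contra hvA
  obtain ⟨e, he, hfst, hsnd⟩ := p.exists_boundary_dart A hyA hvA
  exact h.notMem_of_mem_left (hp _ (p.dart_snd_mem_support_of_mem_darts he))
    (mem_boundary.2 ⟨.inr ⟨_, hfst, e.adj⟩, hsnd⟩)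

theorem disjoint_reach : Disjoint (reach G Y S) S := by
  rw [Set.disjoint_left]
  rintro v ⟨y, -, p, hp⟩
  exact hp v p.end_mem_support

theorem attached_reach : Attached G Y (reach G Y S) := by
  classical
  rintro v ⟨y, hy, p, hp⟩
  exact ⟨y, hy, p, fun w hw => ⟨y, hy, p.takeUntil w hw, fun z hz =>
    hp z (p.support_takeUntil_subset_support hw hz)⟩⟩

theorem Attached.subset_reach (hD : Attached G Y D) (hS : Disjoint D S) : D ⊆ reach G Y S := by
  intro v hv
  obtain ⟨y, hy, p, hp⟩ := hD v hv
  exact ⟨y, hy, p, fun w hw => hS.notMem_of_mem_left (hp w hw)⟩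

theorem boundary_reach_subset : boundary G Y (reach G Y S) ⊆ S := by
  intro v hv
  by_contra hvS
  have hdisj : Disjoint (insert v (reach G Y S)) S :=
    Set.disjoint_insert_left.2 ⟨hvS, disjoint_reach⟩
  exact hv.2 ((attached_reach.insert hv).subset_reach hdisj (Set.mem_insert v _))

theorem reach_subset_of_boundary_subset (h : boundary G Y A ⊆ S) : reach G Y S ⊆ A :=
  attached_reach.subset_of_disjoint_boundary (disjoint_reach.mono_right h)

end Boundary

section Region

variable {V : Type*} {G : SimpleGraph V} {Y A B D L L' F F' : Set V} {v : V} {k m r s : ℕ}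

variable (G Y) in
/-- The candidates of the search for leftmost separators: attached sets `D ⊇ L` that avoid `F` and
have at most `k` boundary vertices. The search decides vertices one by one: `L` holds the vertices
placed in `D`, and `F` those excluded from it. -/
structure IsRegion (L F : Set V) (k : ℕ) (D : Set V) : Prop where
  attached : Attached G Y D
  subset : L ⊆ D
  disjoint : Disjoint D F
  encard_boundary_le : (boundary G Y D).encard ≤ k

theorem IsRegion.mono (hD : IsRegion G Y L F k D) (hL : L' ⊆ L) (hF : F' ⊆ F) :
    IsRegion G Y L' F' k D :=
  ⟨hD.attached, hL.trans hD.subset, hD.disjoint.mono_right hF, hD.encard_boundary_le⟩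

theorem exists_isRegion_subset (hL : Attached G Y L) (hLA : L ⊆ A) (hA : Disjoint A F)
    (hk : (boundary G Y A).encard ≤ k) : ∃ C ⊆ A, IsRegion G Y L F k C := by
  obtain ⟨T, hT⟩ := (Set.finite_of_encard_le_coe hk).exists_finset_coe
  have hsub : reach G Y T ⊆ A := reach_subset_of_boundary_subset hT.ge
  refine ⟨reach G Y T, hsub, attached_reach, hL.subset_reach ?_, hA.mono_left hsub, ?_⟩
  · rw [hT]
    exact (disjoint_boundary A).mono_left hLA
  · exact (Set.encard_le_encard (boundary_reach_subset.trans hT.le)).trans hk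

theorem IsRegion.exists_maximal (hA : IsRegion G Y L F k A) :
    ∃ B, A ⊆ B ∧ Maximal (IsRegion G Y L F k) B := by
  refine zorn_subset_nonempty {D | IsRegion G Y L F k D} (fun c hc hchain hne => ?_) A hA
  refine ⟨⋃₀ c, ⟨attached_sUnion fun D hD => (hc hD).attached, ?_, ?_, ?_⟩,
    fun D => Set.subset_sUnion_of_mem⟩
  · obtain ⟨D, hD⟩ := hne
    exact (hc hD).subset.trans (Set.subset_sUnion_of_mem hD)
  · exact Set.disjoint_sUnion_left.2 fun D hD => (hc hD).disjoint
  · exact encard_boundary_sUnion_le hchain.directedOn hne fun D hD => (hc hD).encard_boundary_le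

/-- By submodularity, joining a region with the fewest possible boundary vertices to another region
does not enlarge the boundary of the latter. -/
theorem IsRegion.subset_of_maximal (hL : Attached G Y L)
    (hmin : ∀ j D, IsRegion G Y L F j D → m ≤ j) (hB : IsRegion G Y L F m B)
    (hD : Maximal (IsRegion G Y L F k) D) : B ⊆ D := by
  have hinter : m ≤ (boundary G Y (D ∩ B)).encard := by
    by_contra! hlt
    obtain ⟨j, hj⟩ := ENat.ne_top_iff_exists.1 hlt.ne_top
    obtain ⟨C, -, hC⟩ := exists_isRegion_subset hL (Set.subset_inter hD.prop.subset hB.subset)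
      (hB.disjoint.mono_left Set.inter_subset_right) hj.ge
    rw [← hj] at hlt
    exact (hmin j C hC).not_gt (by exact_mod_cast hlt)
  have hunion : (boundary G Y (D ∪ B)).encard ≤ k := by
    have hsub := encard_boundary_union_add_encard_boundary_inter_le (G := G) (Y := Y) D B
    refine (ENat.add_le_add_iff_right (ENat.natCast_ne_top m)).1 ?_
    calc (boundary G Y (D ∪ B)).encard + m
        ≤ (boundary G Y (D ∪ B)).encard + (boundary G Y (D ∩ B)).encard := by gcongr
      _ ≤ (boundary G Y D).encard + (boundary G Y B).encard := hsub
      _ ≤ k + m := add_le_add hD.prop.encard_boundary_le hB.encard_boundary_le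
  have hregion : IsRegion G Y L F k (D ∪ B) :=
    ⟨hD.prop.attached.union hB.attached, hD.prop.subset.trans Set.subset_union_left,
      hD.prop.disjoint.union_left hB.disjoint, hunion⟩
  exact Set.subset_union_right.trans (hD.le_of_ge hregion Set.subset_union_left)

theorem maximal_isRegion_mono (hD : Maximal (IsRegion G Y L F k) D) (hL : L ⊆ L') (hF : F ⊆ F')
    (hLD : L' ⊆ D) (hDF : Disjoint D F') : Maximal (IsRegion G Y L' F' k) D :=
  hD.mono (fun _ hE => hE.mono hL hF) ⟨hD.prop.attached, hLD, hDF, hD.prop.encard_boundary_le⟩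

theorem encard_maximal_isRegion_le_add (L F : Set V) (k : ℕ) (v : V) :
    {D | Maximal (IsRegion G Y L F k) D}.encard ≤
      {D | Maximal (IsRegion G Y L (insert v F) k) D}.encard +
        {D | Maximal (IsRegion G Y (insert v L) F k) D}.encard := by
  refine (Set.encard_le_encard fun D (hD : Maximal _ D) => ?_).trans (Set.encard_union_le _ _)
  by_cases hv : v ∈ D
  · exact .inr (maximal_isRegion_mono hD (Set.subset_insert v L) subset_rfl
      (Set.insert_subset hv hD.prop.subset) hD.prop.disjoint)
  · exact .inl (maximal_isRegion_mono hD subset_rfl (Set.subset_insert v F) hD.prop.subset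
      (Set.disjoint_insert_right.2 ⟨hv, hD.prop.disjoint⟩))

theorem IsRegion.exists_mem_boundary_sdiff (hD : IsRegion G Y L F k D) (hB : ¬ D ⊆ B) :
    ∃ v ∈ D, v ∈ boundary G Y B \ F := by
  obtain ⟨v, hvD, hvB⟩ := Set.not_disjoint_iff.1 (mt hD.attached.subset_of_disjoint_boundary hB)
  exact ⟨v, hvD, hvB, hD.disjoint.notMem_of_mem_left hvD⟩

theorem encard_maximal_isRegion_le_one (hL : Attached G Y L)
    (hmin : ∀ j D, IsRegion G Y L F j D → m ≤ j) :
    {D | Maximal (IsRegion G Y L F m) D}.encard ≤ 1 :=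
  Set.encard_le_one_iff.2 fun _ _ hA hB =>
    (hA.prop.subset_of_maximal hL hmin hB).antisymm (hB.prop.subset_of_maximal hL hmin hA)

theorem subsingleton_boundary_sdiff (hB : IsRegion G Y L F m B)
    (hfree : (m : ℕ∞) ≤ (boundary G Y L ∩ F).encard + 1) :
    (boundary G Y B \ F).Subsingleton := by
  have hne : (boundary G Y B ∩ F).encard ≠ ⊤ := ne_top_of_le_ne_top (ENat.natCast_ne_top m)
    ((Set.encard_le_encard Set.inter_subset_left).trans hB.encard_boundary_le)
  rw [← Set.encard_le_one_iff_subsingleton, ← ENat.add_le_add_iff_right hne]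
  calc (boundary G Y B \ F).encard + (boundary G Y B ∩ F).encard
      = (boundary G Y B).encard := Set.encard_sdiff_add_encard_inter _ F
    _ ≤ (boundary G Y L ∩ F).encard + 1 := hB.encard_boundary_le.trans hfree
    _ ≤ 1 + (boundary G Y B ∩ F).encard := by
      rw [add_comm]
      exact add_le_add_right (Set.encard_le_encard (boundary_inter_subset hB.subset hB.disjoint)) 1

theorem succ_le_of_isRegion_insert (hmin : ∀ j D, IsRegion G Y L F j D → m ≤ j)
    (hB : Maximal (IsRegion G Y L F m) B) (hv : v ∉ B) {j : ℕ} {D : Set V}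
    (hD : IsRegion G Y (insert v B) F j D) : m + 1 ≤ j := by
  have hBD : B ⊆ D := (Set.subset_insert v B).trans hD.subset
  have hD' : IsRegion G Y L F j D :=
    ⟨hD.attached, hB.prop.subset.trans hBD, hD.disjoint, hD.encard_boundary_le⟩
  refine Nat.succ_le_of_lt ((hmin j D hD').lt_of_ne ?_)
  rintro rfl
  exact hv (hB.le_of_ge hD' hBD (hD.subset (Set.mem_insert v B)))

theorem encard_maximal_isRegion_le_add_of_branches {a b : ℕ∞} (hL : Attached G Y L)
    (hmin : ∀ j D, IsRegion G Y L F j D → m ≤ j) (hB : Maximal (IsRegion G Y L F m) B)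
    (hb : 1 ≤ b)
    (hinsert : ∀ v ∈ boundary G Y B \ F,
      {D | Maximal (IsRegion G Y (insert v B) F k) D}.encard ≤ b)
    (hexclude : (boundary G Y B \ F).Subsingleton ∨ ∀ v ∈ boundary G Y B \ F,
      {D | Maximal (IsRegion G Y B (insert v F) k) D}.encard ≤ a) :
    {D | Maximal (IsRegion G Y L F k) D}.encard ≤ a + b := by
  have hBD : ∀ D, Maximal (IsRegion G Y L F k) D → B ⊆ D := fun D hD =>
    hB.prop.subset_of_maximal hL hmin hD
  have hrestrict : ∀ D, Maximal (IsRegion G Y L F k) D → Maximal (IsRegion G Y B F k) D :=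
    fun D hD => maximal_isRegion_mono hD hB.prop.subset subset_rfl (hBD D hD) hD.prop.disjoint
  by_cases hlarger : ∃ E, IsRegion G Y B F k E ∧ ¬ E ⊆ B
  swap
  · push Not at hlarger
    have heq : ∀ D, Maximal (IsRegion G Y L F k) D → D = B := fun D hD =>
      (hlarger D (hrestrict D hD).prop).antisymm (hBD D hD)
    calc {D | Maximal (IsRegion G Y L F k) D}.encard ≤ 1 :=
          Set.encard_le_one_iff.2 fun C D hC hD => (heq C hC).trans (heq D hD).symm
      _ ≤ a + b := hb.trans le_add_self
  obtain ⟨E, hE, hEB⟩ := hlarger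
  obtain ⟨v, -, hv⟩ := hE.exists_mem_boundary_sdiff hEB
  obtain hsub | hexclude := hexclude
  · refine (Set.encard_le_encard fun D hD => ?_).trans ((hinsert v hv).trans le_add_self)
    have hDB : ¬ D ⊆ B := fun h =>
      hEB (((hrestrict D hD).le_of_ge hE (h.trans hE.subset)).trans h)
    obtain ⟨w, hwD, hw⟩ := (hrestrict D hD).prop.exists_mem_boundary_sdiff hDB
    obtain rfl := hsub hv hw
    exact maximal_isRegion_mono (hrestrict D hD) (Set.subset_insert v B) subset_rfl
      (Set.insert_subset hwD (hBD D hD)) hD.prop.disjoint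
  · calc {D | Maximal (IsRegion G Y L F k) D}.encard
        ≤ {D | Maximal (IsRegion G Y B F k) D}.encard := Set.encard_le_encard hrestrict
      _ ≤ _ := encard_maximal_isRegion_le_add B F k v
      _ ≤ a + b := add_le_add (hexclude v hv) (hinsert v hv)

/-- Placing a boundary vertex in the region costs one unit of the surplus `s` over the least
boundary size `m`; excluding it for good uses up one of the at most `r + 1` boundary vertices that
are still free. -/
theorem encard_maximal_isRegion_le (hL : Attached G Y L)
    (hmin : ∀ j D, IsRegion G Y L F j D → m ≤ j)
    (hfree : (m : ℕ∞) ≤ (boundary G Y L ∩ F).encard + (r + 1 : ℕ)) (hk : m + s = k) :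
    {D | Maximal (IsRegion G Y L F k) D}.encard ≤ ballot (r + 1) s := by
  induction s generalizing r m L F with
  | zero =>
    obtain rfl : m = k := hk
    simpa only [ballot_zero_right, Nat.cast_one] using encard_maximal_isRegion_le_one hL hmin
  | succ s ihs =>
  induction r using Nat.strong_induction_on generalizing L F with | _ r ihr =>
  have hsucc : ((m + 1 : ℕ) : ℕ∞) ≤ (boundary G Y L ∩ F).encard + (r + 1 + 1 : ℕ) := by
    rw [Nat.cast_add, Nat.cast_add (r + 1), ← add_assoc]
    gcongr
  by_cases hexists : ∃ A, IsRegion G Y L F m A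
  swap
  · have hmin' : ∀ j D, IsRegion G Y L F j D → m + 1 ≤ j := fun j D hD =>
      Nat.succ_le_of_lt ((hmin j D hD).lt_of_ne fun h => hexists ⟨D, h ▸ hD⟩)
    exact (ihs hL hmin' hsucc (by lia)).trans (mod_cast ballot_add_two_le r s)
  obtain ⟨A, hA⟩ := hexists
  obtain ⟨B, -, hB⟩ := hA.exists_maximal
  rw [ballot_succ_succ, Nat.cast_add]
  refine encard_maximal_isRegion_le_add_of_branches hL hmin hB
    (mod_cast one_le_ballot_succ (r + 1) s) (fun v hv => ?_) ?_
  · have hsub : boundary G Y L ∩ F ⊆ boundary G Y (insert v B) ∩ F :=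
      boundary_inter_subset (hB.prop.subset.trans (Set.subset_insert v B))
        (Set.disjoint_insert_left.2 ⟨hv.2, hB.prop.disjoint⟩)
    exact ihs (hB.prop.attached.insert hv.1)
      (fun j D hD => succ_le_of_isRegion_insert hmin hB hv.1.2 hD)
      (hsucc.trans (add_le_add_left (Set.encard_le_encard hsub) _)) (by lia)
  obtain _ | r := r
  · exact .inl (subsingleton_boundary_sdiff hB.prop (mod_cast hfree))
  · refine .inr fun v hv => ihr r r.lt_succ_self hB.prop.attached
      (fun j D hD => hmin j D (hD.mono hB.prop.subset (Set.subset_insert v F))) ?_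
    calc (m : ℕ∞) ≤ (boundary G Y L ∩ F).encard + 1 + (r + 1 : ℕ) := by
          rw [add_assoc, add_comm 1]
          exact_mod_cast hfree
      _ ≤ _ := add_le_add_left
        (encard_boundary_inter_add_one_le hB.prop.subset hB.prop.disjoint hv) _

end Region

section Separator

variable {V : Type*} {G : SimpleGraph V} {X Y D E : Set V} {S T : Finset V} {k : ℕ}

theorem isSeparator_iff_disjoint_reach :
    IsSeparator G X Y S ↔ Disjoint X (reach G Y S) := by
  rw [Set.disjoint_left]
  refine ⟨fun hS x hx ⟨y, hy, p, hp⟩ => ?_, fun hS x hx y hy p => ?_⟩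
  · obtain ⟨w, hw, hwS⟩ := hS x hx y hy p.reverse
    exact hp w (by simpa using hw) hwS
  · by_contra! hp
    exact hS hx ⟨y, hy, p.reverse, by simpa using hp⟩

theorem isSeparator_comm : IsSeparator G X Y S ↔ IsSeparator G Y X S := by
  refine ⟨fun hS y hy x hx p => ?_, fun hS x hx y hy p => ?_⟩ <;>
  · obtain ⟨w, hw, hwS⟩ := hS _ ‹_› _ ‹_› p.reverse
    exact ⟨w, by simpa using hw, hwS⟩

theorem minimal_isSeparator_comm :
    Minimal (IsSeparator G X Y) S ↔ Minimal (IsSeparator G Y X) S := by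
  simp only [Minimal, isSeparator_comm (X := X)]

theorem IsSeparator.disjoint_reach (hS : IsSeparator G X Y S) :
    Disjoint (reach G X S) (reach G Y S) := by
  rw [Set.disjoint_left]
  rintro v ⟨x, hx, p, hp⟩ ⟨y, hy, q, hq⟩
  obtain ⟨w, hw, hwS⟩ := hS x hx y hy (p.append q.reverse)
  rw [SimpleGraph.Walk.mem_support_append_iff, SimpleGraph.Walk.support_reverse,
    List.mem_reverse] at hw
  exact hw.elim (hp w · hwS) (hq w · hwS)

theorem isSeparator_of_boundary_subset (hD : Disjoint X D) (hT : boundary G Y D ⊆ T) :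
    IsSeparator G X Y T :=
  isSeparator_iff_disjoint_reach.2 (hD.mono_right (reach_subset_of_boundary_subset hT))

theorem boundary_reach (hS : Minimal (IsSeparator G X Y) S) :
    boundary G Y (reach G Y S) = S := by
  have hsub : boundary G Y (reach G Y S) ⊆ S := boundary_reach_subset
  obtain ⟨T, hT⟩ := (S.finite_toSet.subset hsub).exists_finset_coe
  have hTS : T ⊆ S := by exact_mod_cast hT.trans_subset hsub
  have hsep : IsSeparator G X Y T :=
    isSeparator_of_boundary_subset (isSeparator_iff_disjoint_reach.1 hS.prop) hT.ge
  exact hsub.antisymm ((Finset.coe_subset.2 (hS.le_of_le hsep hTS)).trans_eq hT)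

theorem reach_injOn : Set.InjOn (reach G Y) {S | Minimal (IsSeparator G X Y) S} := by
  intro S hS T hT h
  rw [← Finset.coe_inj, ← boundary_reach hS, ← boundary_reach hT, h]

theorem reach_subset_reach_swap (hS : IsSeparator G X Y S) (hT : Minimal (IsSeparator G X Y) T)
    (h : reach G X T ⊆ reach G X S) : reach G Y S ⊆ reach G Y T := by
  refine attached_reach.subset_reach (Set.disjoint_left.2 fun v hvS hvT => ?_)
  rw [← boundary_reach (minimal_isSeparator_comm.1 hT)] at hvT
  exact disjoint_reach.notMem_of_mem_left hvS (boundary_reach_subset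
    (boundary_sdiff_subset h ⟨hvT, hS.disjoint_reach.notMem_of_mem_right hvS⟩))

theorem reach_subset_reach_iff (hS : Minimal (IsSeparator G X Y) S)
    (hT : Minimal (IsSeparator G X Y) T) :
    reach G X T ⊆ reach G X S ↔ reach G Y S ⊆ reach G Y T :=
  ⟨reach_subset_reach_swap hS.prop hT,
    reach_subset_reach_swap (isSeparator_comm.1 hT.prop) (minimal_isSeparator_comm.1 hS)⟩

theorem IsRegion.exists_isMinimalSeparatorLE (hE : IsRegion G Y ∅ X k E) :
    ∃ T, IsMinimalSeparatorLE G X Y k T ∧ E ⊆ reach G Y T := by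
  obtain ⟨U, hU⟩ := (Set.finite_of_encard_le_coe hE.encard_boundary_le).exists_finset_coe
  have hUk : U.card ≤ k := by
    have hle := hU ▸ hE.encard_boundary_le
    rwa [Set.encard_coe_eq_coe_finsetCard, Nat.cast_le] at hle
  obtain ⟨T, hTU, hT⟩ := exists_minimal_le_of_wellFoundedLT (IsSeparator G X Y) U
    (isSeparator_of_boundary_subset hE.disjoint.symm hU.ge)
  refine ⟨T, ⟨hT, (Finset.card_le_card hTU).trans hUk⟩, hE.attached.subset_reach ?_⟩
  exact (disjoint_boundary E).mono_right ((Finset.coe_subset.2 hTU).trans_eq hU)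

theorem IsLeftmost.maximal_isRegion (hS : IsLeftmost G X Y k S) :
    Maximal (IsRegion G Y ∅ X k) (reach G Y S) := by
  obtain ⟨⟨hmin, hk⟩, hleft⟩ := hS
  refine ⟨⟨attached_reach, Set.empty_subset _, ?_, ?_⟩, fun E hE hSE => ?_⟩
  · exact (isSeparator_iff_disjoint_reach.1 hmin.prop).symm
  · rw [boundary_reach hmin, Set.encard_coe_eq_coe_finsetCard]
    exact_mod_cast hk
  · obtain ⟨T, hT, hET⟩ := hE.exists_isMinimalSeparatorLE
    obtain rfl : T = S := by
      by_contra hTS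
      exact hleft ⟨T, hTS, hT, (reach_subset_reach_iff hmin hT.1).2 (hSE.trans hET)⟩
    exact hET

theorem eq_empty_of_minimal_isSeparator (h : IsSeparator G X Y ∅)
    (hS : Minimal (IsSeparator G X Y) S) : S = ∅ :=
  Finset.subset_empty.1 (hS.le_of_le h S.empty_subset)

theorem encard_le_one_of_isSeparator_empty (h : IsSeparator G X Y ∅) {A : Set (Finset V)}
    (hA : ∀ S ∈ A, Minimal (IsSeparator G X Y) S) : A.encard ≤ 1 :=
  Set.encard_le_one_iff.2 fun S T hS hT =>
    (eq_empty_of_minimal_isSeparator h (hA S hS)).trans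
      (eq_empty_of_minimal_isSeparator h (hA T hT)).symm

theorem encard_isLeftmost_le (G : SimpleGraph V) (X Y : Set V) {k : ℕ} (hk : 1 ≤ k) :
    {S | IsLeftmost G X Y k S}.encard ≤ catalan (k - 1) := by
  by_cases hempty : IsSeparator G X Y ∅
  · exact (encard_le_one_of_isSeparator_empty hempty fun S hS => hS.1.1).trans
      (mod_cast one_le_catalan (k - 1))
  have hmin : ∀ j D, IsRegion G Y ∅ X j D → 1 ≤ j := by
    intro j D hD
    by_contra! hj
    obtain rfl : j = 0 := Nat.lt_one_iff.1 hj
    refine hempty (isSeparator_of_boundary_subset hD.disjoint.symm ?_)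
    simpa using hD.encard_boundary_le
  calc {S | IsLeftmost G X Y k S}.encard
      ≤ {D | Maximal (IsRegion G Y ∅ X k) D}.encard :=
        Set.encard_le_encard_of_injOn (f := reach G Y) (fun S hS => hS.maximal_isRegion)
          (reach_injOn.mono fun S hS => hS.1.1)
    _ ≤ ballot 1 (k - 1) :=
        encard_maximal_isRegion_le attached_empty hmin (by simp) (Nat.add_sub_of_le hk)
    _ = catalan (k - 1) := by rw [ballot_one]

theorem isImportant_iff :
    IsImportant G X Y k S ↔ IsLeftmost G X Y S.card S ∧ S.card ≤ k := by
  have hdom : ∀ T, T ≠ S → Minimal (IsSeparator G X Y) S → Minimal (IsSeparator G X Y) T →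
      (AtLeastAsLeft G X T S ↔ reach G Y S ⊂ reach G Y T) := fun T hTS hS hT => by
    rw [AtLeastAsLeft, reach_subset_reach_iff hS hT, Set.ssubset_iff_subset_ne,
      and_iff_left fun h => hTS (reach_injOn hT hS h.symm)]
  simp only [IsImportant, IsLeftmost, IsMinimalSeparatorLE, Dominates]
  grind

theorem setOf_isImportant_succ (G : SimpleGraph V) (X Y : Set V) (k : ℕ) :
    {S | IsImportant G X Y (k + 1) S} =
      {S | IsImportant G X Y k S} ∪ {S | IsLeftmost G X Y (k + 1) S ∧ S.card = k + 1} := by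
  ext S
  simp only [Set.mem_union, Set.mem_ofPred_eq, isImportant_iff, Nat.le_succ_iff]
  grind

theorem encard_isImportant_le (G : SimpleGraph V) (X Y : Set V) {k : ℕ} (hk : 1 ≤ k) :
    {S | IsImportant G X Y k S}.encard ≤ (∑ i ∈ Finset.range k, catalan i : ℕ) := by
  by_cases hempty : IsSeparator G X Y ∅
  · refine (encard_le_one_of_isSeparator_empty hempty fun S hS => hS.1.1).trans ?_
    exact_mod_cast (one_le_catalan 0).trans
      (Finset.single_le_sum (fun i _ => Nat.zero_le _) (Finset.mem_range.2 hk))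
  clear hk
  induction k with
  | zero =>
    have hnone : {S | IsImportant G X Y 0 S} = ∅ := by
      refine Set.eq_empty_of_forall_notMem fun S hS => hempty ?_
      rw [← Finset.card_eq_zero.1 (Nat.le_zero.1 hS.1.2)]
      exact hS.1.1.prop
    simp [hnone]
  | succ k ih =>
    rw [setOf_isImportant_succ, Finset.sum_range_succ, Nat.cast_add]
    refine (Set.encard_union_le _ _).trans (add_le_add ih ?_)
    exact (Set.encard_le_encard fun S hS => hS.1).trans
      (encard_isLeftmost_le G X Y (Nat.le_add_left 1 k))

theorem sum_le_encard_isImportant {c : ℕ → ℕ∞} (h : ∀ i < k,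
      c i ≤ {S | IsLeftmost G X Y (i + 1) S ∧ S.card = i + 1}.encard) :
    ∑ i ∈ Finset.range k, c i ≤ {S | IsImportant G X Y k S}.encard := by
  induction k with
  | zero => simp
  | succ k ih =>
    rw [setOf_isImportant_succ, Finset.sum_range_succ, Set.encard_union_eq]
    · exact add_le_add (ih fun i hi => h i (hi.trans k.lt_succ_self)) (h k k.lt_succ_self)
    · exact Set.disjoint_left.2 fun S hS hS' => hS.1.2.not_gt (by simp [hS'.2])

end Separator

section BinaryTree

theorem eq_of_cons_suffix_of_cons_suffix {α : Type*} {w x : List α} {b c : α}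
    (hb : b :: w <:+ x) (hc : c :: w <:+ x) : b = c :=
  (List.cons_eq_cons.1 ((List.suffix_of_suffix_length_le hb hc le_rfl).eq_of_length rfl)).1

theorem exists_cons_suffix {α : Type*} {w x : List α} (h : w <:+ x) (hlt : w.length < x.length) :
    ∃ b, b :: w <:+ x := by
  obtain ⟨u, rfl⟩ := h
  obtain ⟨u, b, rfl⟩ := List.eq_nil_or_concat u |>.resolve_left (by rintro rfl; simp at hlt)
  exact ⟨b, by simp⟩

variable {d k n : ℕ} {w x : List Bool} {b : Bool} {t : BinaryTree Unit}
  {S T : Finset (BinVertex d)} {v : BinVertex d}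

/-- The positions of the leaves of `t` when its root is placed at the vertex `w` of the infinite
binary tree. Placed at the root, these sets are the leftmost separators of the complete binary
tree. -/
def leavesBelow : List Bool → BinaryTree Unit → Finset (List Bool)
  | w, .nil => {w}
  | w, .node _ l r => leavesBelow (false :: w) l ∪ leavesBelow (true :: w) r

theorem suffix_of_mem_leavesBelow (hx : x ∈ leavesBelow w t) : w <:+ x := by
  induction t generalizing w with
  | nil => simp_all [leavesBelow]
  | node _ l r ihl ihr =>
    obtain hl | hr := Finset.mem_union.1 hx
    · exact (List.suffix_cons _ _).trans (ihl hl)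
    · exact (List.suffix_cons _ _).trans (ihr hr)

theorem mem_leavesBelow_node_iff {a : Unit} {l r : BinaryTree Unit} (h : b :: w <:+ x) :
    x ∈ leavesBelow w (.node a l r) ↔ x ∈ leavesBelow (b :: w) (bif b then r else l) := by
  have hne (s : BinaryTree Unit) : x ∉ leavesBelow ((!b) :: w) s := fun hx =>
    Bool.not_ne_self b (eq_of_cons_suffix_of_cons_suffix (suffix_of_mem_leavesBelow hx) h)
  rw [leavesBelow, Finset.mem_union]
  cases b
  · exact or_iff_left (hne r)
  · exact or_iff_right (hne l)

theorem exists_mem_leavesBelow_cons {a : Unit} {l r : BinaryTree Unit}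
    (hx : x ∈ leavesBelow w (.node a l r)) :
    ∃ b, x ∈ leavesBelow (b :: w) (bif b then r else l) :=
  (Finset.mem_union.1 hx).elim (fun h => ⟨false, h⟩) (fun h => ⟨true, h⟩)

theorem length_le_of_mem_leavesBelow (hx : x ∈ leavesBelow w t) :
    x.length ≤ w.length + t.height := by
  induction t generalizing w with
  | nil => simp_all [leavesBelow]
  | node _ l r ihl ihr =>
    simp only [BinaryTree.height]
    obtain hl | hr := Finset.mem_union.1 hx
    · grind [ihl hl]
    · grind [ihr hr]

theorem exists_mem_leavesBelow_suffix (h : w <:+ x) (hlen : w.length + t.height ≤ x.length) :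
    ∃ s ∈ leavesBelow w t, s <:+ x := by
  induction t generalizing w with
  | nil => exact ⟨w, by simp [leavesBelow], h⟩
  | node _ l r ihl ihr =>
    simp only [BinaryTree.height] at hlen
    obtain ⟨b, hb⟩ := exists_cons_suffix h (by lia)
    cases b
    · obtain ⟨s, hs, hsx⟩ := ihl hb (by grind)
      exact ⟨s, Finset.mem_union_left _ hs, hsx⟩
    · obtain ⟨s, hs, hsx⟩ := ihr hb (by grind)
      exact ⟨s, Finset.mem_union_right _ hs, hsx⟩

theorem isAntichain_leavesBelow (w : List Bool) (t : BinaryTree Unit) :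
    IsAntichain (· <:+ ·) (leavesBelow w t : Set (List Bool)) := by
  induction t generalizing w with
  | nil => simp [leavesBelow]
  | node _ l r ihl ihr =>
    intro x hx y hy hne hxy
    obtain ⟨b, hb⟩ := exists_mem_leavesBelow_cons hx
    have hy' := (mem_leavesBelow_node_iff ((suffix_of_mem_leavesBelow hb).trans hxy)).1 hy
    cases b
    · exact ihl _ hb hy' hne hxy
    · exact ihr _ hb hy' hne hxy

theorem card_leavesBelow (w : List Bool) (t : BinaryTree Unit) :
    (leavesBelow w t).card = t.numNodes + 1 := by
  induction t generalizing w with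
  | nil => simp [leavesBelow]
  | node _ l r ihl ihr =>
    rw [leavesBelow, Finset.card_union_of_disjoint, ihl, ihr, BinaryTree.numNodes]
    · lia
    · refine Finset.disjoint_left.2 fun x hl hr => Bool.false_ne_true ?_
      exact eq_of_cons_suffix_of_cons_suffix (suffix_of_mem_leavesBelow hl)
        (suffix_of_mem_leavesBelow hr)

theorem self_mem_leavesBelow_iff : w ∈ leavesBelow w t ↔ t = .nil := by
  refine ⟨fun hw => ?_, fun ht => by simp [ht, leavesBelow]⟩
  cases t with
  | nil => rfl
  | node _ l r =>
    obtain ⟨b, hb⟩ := exists_mem_leavesBelow_cons hw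
    exact absurd (suffix_of_mem_leavesBelow hb).length_le (by simp)

theorem leavesBelow_injective (w : List Bool) : Function.Injective (leavesBelow w) := by
  intro t t' h
  induction t generalizing w t' with
  | nil => exact (self_mem_leavesBelow_iff.1 (h ▸ self_mem_leavesBelow_iff.2 rfl)).symm
  | node _ l r ihl ihr =>
    cases t' with
    | nil => exact self_mem_leavesBelow_iff.1 (h ▸ self_mem_leavesBelow_iff.2 rfl)
    | node _ l' r' =>
      have hchild (b : Bool) : leavesBelow (b :: w) (bif b then r else l) =
          leavesBelow (b :: w) (bif b then r' else l') := by
        ext x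
        by_cases hx : b :: w <:+ x
        · rw [← mem_leavesBelow_node_iff hx, h, mem_leavesBelow_node_iff hx]
        · exact iff_of_false (mt suffix_of_mem_leavesBelow hx) (mt suffix_of_mem_leavesBelow hx)
      obtain rfl := ihl _ (hchild false)
      obtain rfl := ihr _ (hchild true)
      rfl

theorem mem_reach_treeRoot_iff :
    v ∈ reach (completeBinaryTree d) {treeRoot d} T ↔ ∀ s ∈ T, ¬ s.1 <:+ v.1 := by
  refine ⟨fun hv => ?_, fun hv => ?_⟩
  · refine reach_subset_of_boundary_subset (A := {v | ∀ s ∈ T, ¬ s.1 <:+ v.1}) (fun u hu => ?_) hv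
    obtain ⟨hu, hmem⟩ := mem_boundary.1 hu
    obtain ⟨s, hsT, hsu⟩ : ∃ s ∈ T, s.1 <:+ u.1 := by simpa using hmem
    suffices hus : s = u from hus ▸ hsT
    obtain rfl | ⟨w, hw, ⟨b, hb⟩ | ⟨b, hb⟩⟩ := hu
    · exact Subtype.ext (List.suffix_nil.1 hsu)
    · rw [hb, List.suffix_cons_iff, ← hb] at hsu
      exact Subtype.ext (hsu.resolve_right (hw s hsT))
    · exact absurd (hsu.trans (hb ▸ List.suffix_cons b u.1)) (hw s hsT)
  · obtain ⟨l, hl⟩ := v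
    induction l with
    | nil =>
      by_contra hroot
      exact hv _ (boundary_reach_subset
        (mem_boundary.2 ⟨.inl (Set.mem_singleton (treeRoot d)), hroot⟩)) List.suffix_rfl
    | cons b l ih =>
      have hparent := ih (Nat.le_of_succ_le hl) fun s hs h =>
        hv s hs (h.trans (List.suffix_cons b l))
      by_contra hchild
      exact hv _ (boundary_reach_subset
        (mem_boundary.2 ⟨.inr ⟨_, hparent, .inl ⟨b, rfl⟩⟩, hchild⟩)) List.suffix_rfl

theorem isSeparator_treeLeaves_iff :
    IsSeparator (completeBinaryTree d) (treeLeaves d) {treeRoot d} T ↔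
      ∀ x ∈ treeLeaves d, ∃ s ∈ T, s.1 <:+ x.1 := by
  simp only [isSeparator_iff_disjoint_reach, Set.disjoint_left, mem_reach_treeRoot_iff]
  push Not
  rfl

theorem IsSeparator.exists_suffix_or_suffix
    (hT : IsSeparator (completeBinaryTree d) (treeLeaves d) {treeRoot d} T) (v : BinVertex d) :
    ∃ t ∈ T, t.1 <:+ v.1 ∨ v.1 <:+ t.1 := by
  let x : BinVertex d := ⟨List.replicate (d - v.1.length) false ++ v.1, by grind⟩
  obtain ⟨t, ht, htx⟩ := isSeparator_treeLeaves_iff.1 hT x (by grind [treeLeaves])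
  exact ⟨t, ht, List.suffix_or_suffix_of_suffix htx (List.suffix_append _ _)⟩

/-- If `s ∉ T`, then `T` has vertices below both children of `s`, which makes it larger than `S`. -/
theorem eq_of_forall_exists_suffix
    (hS : IsAntichain (fun u v : BinVertex d => u.1 <:+ v.1) (S : Set (BinVertex d)))
    (hdepth : ∀ s ∈ S, s.1.length < d)
    (hT : IsSeparator (completeBinaryTree d) (treeLeaves d) {treeRoot d} T)
    (hTS : ∀ t ∈ T, ∃ s ∈ S, s.1 <:+ t.1) (hcard : T.card ≤ S.card) : T = S := by
  choose! f hfS hf using hTS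
  have hfeq : ∀ s ∈ S, ∀ t ∈ T, s.1 <:+ t.1 → f t = s := fun s hs t ht hst =>
    (List.suffix_or_suffix_of_suffix (hf t ht) hst).elim (hS.eq (hfS t ht) hs)
      fun h => (hS.eq hs (hfS t ht) h).symm
  have hbelow : ∀ s ∈ S, s ∉ T → ∀ b, ∃ t ∈ T, b :: s.1 <:+ t.1 := by
    intro s hs hsT b
    obtain ⟨t, ht, htb | htb⟩ := hT.exists_suffix_or_suffix ⟨b :: s.1, hdepth s hs⟩
    swap
    · exact ⟨t, ht, htb⟩
    obtain heq | hts := List.suffix_cons_iff.1 htb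
    · exact ⟨t, ht, heq ▸ List.suffix_rfl⟩
    · have hfs : f t = s := hS.eq (hfS t ht) hs ((hf t ht).trans hts)
      obtain rfl : t = s := Subtype.ext (hts.eq_of_length_le (hfs ▸ hf t ht).length_le)
      exact absurd ht hsT
  have hsurj : Set.SurjOn f T S := by
    intro s hs
    by_cases hsT : s ∈ T
    · exact ⟨s, hsT, hfeq s hs s hsT List.suffix_rfl⟩
    · obtain ⟨t, ht, hst⟩ := hbelow s hs hsT false
      exact ⟨t, ht, hfeq s hs t ht ((List.suffix_cons _ _).trans hst)⟩
  have hinj : Set.InjOn f T := Finset.injOn_of_surjOn_of_card_le f hfS hsurj hcard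
  refine (Finset.eq_of_subset_of_card_le (fun s hs => ?_) hcard).symm
  by_contra hsT
  obtain ⟨t₀, ht₀, hst₀⟩ := hbelow s hs hsT false
  obtain ⟨t₁, ht₁, hst₁⟩ := hbelow s hs hsT true
  obtain rfl : t₀ = t₁ := hinj ht₀ ht₁
    ((hfeq s hs t₀ ht₀ ((List.suffix_cons _ _).trans hst₀)).trans
      (hfeq s hs t₁ ht₁ ((List.suffix_cons _ _).trans hst₁)).symm)
  exact Bool.false_ne_true (eq_of_cons_suffix_of_cons_suffix hst₀ hst₁)

theorem minimal_isSeparator_of_isAntichain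
    (hS : IsAntichain (fun u v : BinVertex d => u.1 <:+ v.1) (S : Set (BinVertex d)))
    (hsep : IsSeparator (completeBinaryTree d) (treeLeaves d) {treeRoot d} S) :
    Minimal (IsSeparator (completeBinaryTree d) (treeLeaves d) {treeRoot d}) S := by
  refine ⟨hsep, fun T hT hTS s hs => ?_⟩
  obtain ⟨t, ht, hts⟩ := hT.exists_suffix_or_suffix s
  obtain rfl : t = s := hts.elim (hS.eq (hTS ht) hs) fun h => (hS.eq hs (hTS ht) h).symm
  exact ht

theorem isLeftmost_of_isAntichain
    (hS : IsAntichain (fun u v : BinVertex d => u.1 <:+ v.1) (S : Set (BinVertex d)))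
    (hsep : IsSeparator (completeBinaryTree d) (treeLeaves d) {treeRoot d} S)
    (hdepth : ∀ s ∈ S, s.1.length < d) :
    IsLeftmost (completeBinaryTree d) (treeLeaves d) {treeRoot d} S.card S := by
  have hmin := minimal_isSeparator_of_isAntichain hS hsep
  refine ⟨⟨hmin, le_rfl⟩, fun ⟨T, hne, ⟨hT, hcard⟩, hleft⟩ => hne ?_⟩
  refine eq_of_forall_exists_suffix hS hdepth hT.prop (fun t ht => ?_) hcard
  by_contra! hts
  exact disjoint_reach.notMem_of_mem_left
    ((reach_subset_reach_iff hmin hT).1 hleft (mem_reach_treeRoot_iff.2 hts)) ht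

/-- The subtree `t` of the complete binary tree of depth `d` with its root at the root, as the set
of its leaves. -/
def leafVertices (d : ℕ) (t : BinaryTree Unit) : Finset (BinVertex d) :=
  (leavesBelow [] t).subtype _

theorem mem_leafVertices : v ∈ leafVertices d t ↔ v.1 ∈ leavesBelow [] t := Finset.mem_subtype

theorem map_leafVertices (ht : t.height ≤ d) :
    (leafVertices d t).map (.subtype _) = leavesBelow [] t :=
  Finset.subtype_map_of_mem fun x hx => by
    simpa using (length_le_of_mem_leavesBelow hx).trans (by simpa using ht)

theorem card_leafVertices (ht : t.height ≤ d) : (leafVertices d t).card = t.numNodes + 1 := by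
  rw [← card_leavesBelow [] t, ← map_leafVertices ht, Finset.card_map]

theorem leafVertices_injOn : Set.InjOn (leafVertices d) {t | t.height ≤ d} := by
  intro t ht t' ht' h
  refine leavesBelow_injective [] ?_
  rw [← map_leafVertices ht, ← map_leafVertices ht', h]

theorem isLeftmost_leafVertices (ht : t.height < d) :
    IsLeftmost (completeBinaryTree d) (treeLeaves d) {treeRoot d} (t.numNodes + 1)
      (leafVertices d t) := by
  rw [← card_leafVertices ht.le]
  refine isLeftmost_of_isAntichain ?_ ?_ fun s hs => ?_
  · intro u hu v hv hne
    exact isAntichain_leavesBelow [] t (mem_leafVertices.1 hu) (mem_leafVertices.1 hv)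
      (Subtype.coe_ne_coe.2 hne)
  · refine isSeparator_treeLeaves_iff.2 fun x (hx : x.1.length = d) => ?_
    obtain ⟨s, hs, hsx⟩ := exists_mem_leavesBelow_suffix (t := t) x.1.nil_suffix
      (by simpa [hx] using ht.le)
    exact ⟨⟨s, hsx.length_le.trans x.2⟩, mem_leafVertices.2 hs, hsx⟩
  · have := length_le_of_mem_leavesBelow (mem_leafVertices.1 hs)
    exact this.trans_lt (by simpa using ht)

theorem catalan_le_encard_isLeftmost (hn : n < d) :
    catalan n ≤ {S | IsLeftmost (completeBinaryTree d) (treeLeaves d) {treeRoot d} (n + 1) S ∧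
      S.card = n + 1}.encard := by
  have hheight : ∀ t ∈ BinaryTree.treesOfNumNodesEq n, t.height < d := fun t ht =>
    t.height_le_numNodes.trans_lt ((BinaryTree.mem_treesOfNumNodesEq.1 ht).trans_lt hn)
  rw [← BinaryTree.treesOfNumNodesEq_card_eq_catalan, ← Set.encard_coe_eq_coe_finsetCard]
  refine Set.encard_le_encard_of_injOn (f := leafVertices d) (fun t ht => ?_)
    (leafVertices_injOn.mono fun t ht => (hheight t ht).le)
  have hlt := hheight t ht
  obtain rfl := BinaryTree.mem_treesOfNumNodesEq.1 ht
  exact ⟨isLeftmost_leafVertices hlt, card_leafVertices hlt.le⟩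

theorem ncard_isLeftmost_treeLeaves (hk : 1 ≤ k) (hkd : k ≤ d) :
    {S | IsLeftmost (completeBinaryTree d) (treeLeaves d) {treeRoot d} k S}.ncard =
      catalan (k - 1) := by
  obtain ⟨n, rfl⟩ := Nat.exists_eq_add_of_le' hk
  rw [Set.ncard, (encard_isLeftmost_le _ _ _ hk).antisymm
    ((catalan_le_encard_isLeftmost hkd).trans (Set.encard_le_encard fun S hS => hS.1)),
    ENat.toNat_natCast]

theorem ncard_isImportant_treeLeaves (hk : 1 ≤ k) (hkd : k ≤ d) :
    {S | IsImportant (completeBinaryTree d) (treeLeaves d) {treeRoot d} k S}.ncard =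
      ∑ i ∈ Finset.range k, catalan i := by
  have hle : (∑ i ∈ Finset.range k, catalan i : ℕ) ≤
      {S | IsImportant (completeBinaryTree d) (treeLeaves d) {treeRoot d} k S}.encard := by
    rw [Nat.cast_sum]
    exact sum_le_encard_isImportant fun i hi => catalan_le_encard_isLeftmost (hi.trans_le hkd)
  rw [Set.ncard, (encard_isImportant_le _ _ _ hk).antisymm hle, ENat.toNat_natCast]

end BinaryTree

end LeftmostSep

theorem mainTheorem1_general :
    (∀ k : ℕ, 1 ≤ k →
      (∀ (V : Type*) (G : SimpleGraph V) (X Y : Set V),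
        {S : Finset V | LeftmostSep.IsLeftmost G X Y k S}.encard ≤ catalan (k - 1) ∧
        {S : Finset V | LeftmostSep.IsImportant G X Y k S}.encard
          ≤ (∑ i ∈ Finset.range k, catalan i : ℕ)) ∧
      (∀ d : ℕ, k ≤ d →
        {S | LeftmostSep.IsLeftmost (LeftmostSep.completeBinaryTree d)
          (LeftmostSep.treeLeaves d) {LeftmostSep.treeRoot d} k S}.ncard = catalan (k - 1) ∧
        {S | LeftmostSep.IsImportant (LeftmostSep.completeBinaryTree d)
          (LeftmostSep.treeLeaves d) {LeftmostSep.treeRoot d} k S}.ncard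
          = ∑ i ∈ Finset.range k, catalan i) ∧
      (catalan (k - 1) : ℝ) = 1 / (k : ℝ) * ((2 * (k - 1)).choose (k - 1) : ℝ)) ∧
    Asymptotics.IsEquivalent Filter.atTop (fun k : ℕ => (catalan (k - 1) : ℝ))
      (fun k : ℕ => (4 : ℝ) ^ (k - 1) / (√Real.pi * ((k : ℝ) - 1) ^ (3 / 2 : ℝ))) :=
  ⟨fun _ hk =>
    ⟨fun _ G X Y => ⟨LeftmostSep.encard_isLeftmost_le G X Y hk,
      LeftmostSep.encard_isImportant_le G X Y hk⟩,
    fun _ hkd => ⟨LeftmostSep.ncard_isLeftmost_treeLeaves hk hkd,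
      LeftmostSep.ncard_isImportant_treeLeaves hk hkd⟩,
    LeftmostSep.cast_catalan_pred hk⟩,
  LeftmostSep.catalan_pred_isEquivalent⟩

theorem mainTheorem1 :
    (∀ k : ℕ, 1 ≤ k →
      (∀ (V : Type*) [Finite V] (G : SimpleGraph V) (X Y : Set V),
        {S : Finset V | LeftmostSep.IsLeftmost G X Y k S}.ncard ≤ catalan (k - 1) ∧
        {S : Finset V | LeftmostSep.IsImportant G X Y k S}.ncard
          ≤ ∑ i ∈ Finset.range k, catalan i) ∧
      (∀ d : ℕ, k + 1 ≤ d →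
        {S | LeftmostSep.IsLeftmost (LeftmostSep.completeBinaryTree d)
          (LeftmostSep.treeLeaves d) {LeftmostSep.treeRoot d} k S}.ncard = catalan (k - 1) ∧
        {S | LeftmostSep.IsImportant (LeftmostSep.completeBinaryTree d)
          (LeftmostSep.treeLeaves d) {LeftmostSep.treeRoot d} k S}.ncard
          = ∑ i ∈ Finset.range k, catalan i) ∧
      (catalan (k - 1) : ℝ) = 1 / (k : ℝ) * ((2 * (k - 1)).choose (k - 1) : ℝ)) ∧
    Asymptotics.IsEquivalent Filter.atTop (fun k : ℕ => (catalan (k - 1) : ℝ))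
      (fun k : ℕ => (4 : ℝ) ^ (k - 1) / (√Real.pi * ((k : ℝ) - 1) ^ (3 / 2 : ℝ))) :=
  mainTheorem1_general.imp_left fun h k hk => ⟨fun V _ G X Y => ((h k hk).1 V G X Y).imp
    ENat.toNat_le_of_le_natCast ENat.toNat_le_of_le_natCast,
    fun d hd => (h k hk).2.1 d (Nat.le_of_succ_le hd), (h k hk).2.2⟩
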